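/- \textbf{Semi-online bipartite matching.} An instance consists of a finite bipartite graph $G$ with offline side $U$ and online side $V = V_P \sqcup V_A$ (predicted and adversarial nodes) together with an arrival order of $V$. The \emph{predicted graph} $H$ is the subgraph of $G$ induced on $U \cup V_P$. A randomized algorithm knows $H$ in advance and nothing about the number of adversarial nodes, their edges or the arrival order. The nodes of $V$ then arrive one at a time in the given order; on arrival of a node its set of neighbours in $U$ is revealed (and nothing else), and the algorithm must irrevocably either match it to a still unmatched neighbour or abandon it. The instance is fixed before the random choices of the algorithm are made. Let $\nu(I)$ denote the size of a maximum matching of a graph $I$, and put $\delta = 1 - \nu(H)/\nu(G)$. \textbf{Theorem.} There is a randomized algorithm for semi-online bipartite matching such that on every instance, whether or not $G$ has a perfect matching, the expected size of the matching that it builds is at least $$\Bigl(1 - \delta + \delta^2\bigl(1 - \tfrac1e\bigr)\Bigr)\,\nu(G).$$ (If $\nu(G) = 0$, then $\delta$ is not defined and the bound is read as $0$.) -/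

import Mathlib

/-! Semi-online bipartite matching.  A bipartite graph with offline side `U` and online side `V` is
given by the neighbourhood function `N : V → Finset U` of its online nodes. -/

namespace SemiOnline

universe u v w

/-- `M` is a matching of the bipartite graph `N`: all its pairs are edges, and two different pairs
share neither their online nor their offline end. -/
def IsMatching {V : Type w} {U : Type u} (N : V → Finset U) (M : Finset (V × U)) : Prop :=
  (∀ e ∈ M, e.2 ∈ N e.1) ∧ ∀ e ∈ M, ∀ f ∈ M, e.1 = f.1 ∨ e.2 = f.2 → e = f

open Classical in
/-- The size `ν` of a maximum matching. -/
noncomputable def matchingNumber {V : Type w} {U : Type u} [Fintype V] [Fintype U]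
    (N : V → Finset U) : ℕ :=
  (Finset.univ.filter fun M : Finset (V × U) => IsMatching N M).sup Finset.card

/-- A deterministic online strategy.  It sees the neighbourhoods of the online nodes that arrived
so far (oldest first) and the neighbourhood of the node arriving now, and answers with the offline
node to which the arriving node is to be matched, or with `none` to abandon it.  Earlier answers
are determined by the history, so they need not be passed on. -/
abbrev OnlineStrategy (U : Type u) : Type u := List (Finset U) → Finset U → Option U

open Classical in
/-- One irrevocable decision: the arriving node `v` is matched to the answered node `u` if `u` is a
still unmatched neighbour of `v`; in all other cases `v` is abandoned. -/
noncomputable def step {V : Type w} {U : Type u} (N : V → Finset U) (M : Finset (V × U)) (v : V) :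
    Option U → Finset (V × U)
  | none => M
  | some x => if x ∈ N v ∧ ∀ e ∈ M, e.2 ≠ x then insert (v, x) M else M

/-- The online phase, continued from history `h` and current matching `M`, on the nodes that are
still to arrive (in the order of the list). -/
noncomputable def runFrom {V : Type w} {U : Type u} (A : OnlineStrategy U) (N : V → Finset U) :
    List (Finset U) → Finset (V × U) → List V → Finset (V × U)
  | _, M, [] => M
  | h, M, v :: vs => runFrom A N (h ++ [N v]) (step N M v (A h (N v))) vs

/-- The matching that the strategy `A` has built when all nodes have arrived. -/
noncomputable def run {V : Type w} {U : Type u} (A : OnlineStrategy U) (N : V → Finset U)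
    (order : List V) : Finset (V × U) :=
  runFrom A N [] ∅ order

/-- The expected size of the matching built by a random online strategy. -/
noncomputable def expectedSize {V : Type w} {U : Type u} (A : PMF (OnlineStrategy U))
    (N : V → Finset U) (order : List V) : ℝ :=
  ∑' s : OnlineStrategy U, (A s).toReal * ((run s N order).card : ℝ)

/-- A randomized semi-online algorithm.  Its only advance knowledge is the predicted graph `H` on
the offline nodes `U` and the predicted online nodes `P`; from it the algorithm draws at random a
strategy for the online phase. -/
def RandomizedAlgorithm : Type (max (u + 1) (v + 1)) :=
  ∀ (U : Type u) (P : Type v) [Fintype U] [Fintype P], (P → Finset U) → PMF (OnlineStrategy U)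

/-- The real graph: its online nodes are the predicted ones, with their predicted neighbourhoods,
and `d` adversarial ones, with neighbourhoods `adv`. -/
def fullGraph {U : Type u} {P : Type v} (H : P → Finset U) {d : ℕ} (adv : Fin d → Finset U) :
    P ⊕ Fin d → Finset U :=
  Sum.elim H adv

/-- `δ = 1 - ν(H) / ν(G)`. -/
noncomputable def delta {U : Type u} {P : Type v} [Fintype U] [Fintype P] (H : P → Finset U)
    {d : ℕ} (adv : Fin d → Finset U) : ℝ :=
  1 - (matchingNumber H : ℝ) / (matchingNumber (fullGraph H adv) : ℝ)

end SemiOnline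

/-!
The algorithm draws a random maximum matching `M` of the predicted graph, reserves the offline nodes
of `M` for the predicted arrivals, and serves the other arrivals by RANKING on the free nodes.

The law of `M` maximizes the product, over the offline nodes `x` that some maximum matching misses,
of the probabilities `r x` that `M` misses `x`. If `B` is a fixed maximum matching of the predicted
graph, then moving mass towards `B` cannot increase that product, so the sum of `1 / r x` over the
`x` missed by `B` is at most the number of factors. For every set `D` of nodes missed by `B`, the
sum of `1 / r x` over `D` is therefore at most `#B + #D`, and by Cauchy-Schwarz `M` misses at least
`#D ^ 2 / (#B + #D)` nodes of `D` on average. An exchange argument splits a maximum matching of the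
whole graph into a maximum matching `B` of the predicted graph and a matching `O` of adversarial
nodes, and RANKING earns on average at least `1 - 1 / e` times the number of edges of `O` whose
offline end is free.

The competitive ratio of RANKING follows by a primal-dual argument: a matched pair whose offline end
has label `t` pays `exp (t - 1)` to the offline end and the rest to the online end, and the two ends
of every edge receive at least `1 - 1 / e` on average over the label of the offline end.

A predicted arrival need not be recognizable. Every arrival whose neighbours agree with those of a
predicted node that is still missing is treated as that node, which only permutes arrivals that the
algorithm cannot tell apart.
-/

namespace SemiOnline

open MeasureTheory
open scoped Finset

theorem sum_nonpos_of_prod_one_add_mul_le_one {ι : Type*} (s : Finset ι) (r : ι → ℝ)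
    (h : ∀ ε ∈ Set.Ioo (0 : ℝ) 1, ∏ i ∈ s, (1 + ε * r i) ≤ 1) : ∑ i ∈ s, r i ≤ 0 := by
  classical
  have hderiv : HasDerivAt (fun ε : ℝ => ∏ i ∈ s, (1 + ε * r i)) (∑ i ∈ s, r i) 0 := by
    simpa using HasDerivAt.fun_finsetProd (u := s)
      fun i _ => ((hasDerivAt_id (0 : ℝ)).mul_const (r i)).const_add 1
  refine le_of_tendsto hderiv.tendsto_slope_zero_right ?_
  filter_upwards [Ioo_mem_nhdsGT (zero_lt_one' ℝ)] with ε hε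
  have := h ε hε
  simp only [zero_add, zero_mul, add_zero, Finset.prod_const_one, smul_eq_mul]
  exact mul_nonpos_of_nonneg_of_nonpos (inv_nonneg.2 hε.1.le) (by linarith)

/-- A maximizer of the product `∏ i ∈ s, f i` is proportionally fair. -/
theorem exists_pos_forall_sum_div_le_card {ι E : Type*} [AddCommGroup E] [Module ℝ E]
    [TopologicalSpace E] {K : Set E} (hK : IsCompact K) (hconv : Convex ℝ K) (s : Finset ι)
    (f : ι → E →L[ℝ] ℝ) (hf : ∀ i ∈ s, ∀ x ∈ K, 0 ≤ f i x)
    (hpos : ∃ x ∈ K, ∀ i ∈ s, 0 < f i x) :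
    ∃ x ∈ K, (∀ i ∈ s, 0 < f i x) ∧ ∀ y ∈ K, ∑ i ∈ s, f i y / f i x ≤ #s := by
  obtain ⟨x₀, hx₀, hpos₀⟩ := hpos
  have hcont : Continuous fun x => ∏ i ∈ s, f i x :=
    continuous_finsetProd s fun i _ => (f i).continuous
  obtain ⟨x, hx, hmax⟩ := hK.exists_isMaxOn ⟨x₀, hx₀⟩ hcont.continuousOn
  have hprod : 0 < ∏ i ∈ s, f i x := (Finset.prod_pos hpos₀).trans_le (hmax hx₀)
  have hx_pos : ∀ i ∈ s, 0 < f i x := fun i hi =>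
    (hf i hi x hx).lt_of_ne' fun h => hprod.ne' (Finset.prod_eq_zero hi h)
  refine ⟨x, hx, hx_pos, fun y hy => ?_⟩
  have hratio : ∑ i ∈ s, (f i y / f i x - 1) ≤ 0 := by
    refine sum_nonpos_of_prod_one_add_mul_le_one s _ fun ε hε => ?_
    have hmem : (1 - ε) • x + ε • y ∈ K :=
      hconv hx hy (sub_nonneg.2 hε.2.le) hε.1.le (sub_add_cancel 1 ε)
    refine le_of_mul_le_mul_right ?_ hprod
    calc (∏ i ∈ s, (1 + ε * (f i y / f i x - 1))) * ∏ i ∈ s, f i x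
        = ∏ i ∈ s, f i ((1 - ε) • x + ε • y) := by
          rw [← Finset.prod_mul_distrib]
          refine Finset.prod_congr rfl fun i hi => ?_
          have := (hx_pos i hi).ne'
          simp only [map_add, map_smul, smul_eq_mul]
          field_simp
          ring
      _ ≤ 1 * ∏ i ∈ s, f i x := by simpa using hmax hmem
  simpa [Finset.sum_sub_distrib] using hratio

section FairDistribution

variable {B U : Type*} [Fintype B] [DecidableEq U]

/-- The probability that `x` is missed by the set `cov b`, as a function of the law of `b`. -/
noncomputable def missProb (cov : B → Finset U) (x : U) : (B → ℝ) →L[ℝ] ℝ :=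
  ∑ b with x ∉ cov b, ContinuousLinearMap.proj b

theorem missProb_apply (cov : B → Finset U) (x : U) (w : B → ℝ) :
    missProb cov x w = ∑ b with x ∉ cov b, w b := by
  simp [missProb]

theorem missProb_nonneg (cov : B → Finset U) (x : U) {w : B → ℝ} (hw : w ∈ stdSimplex ℝ B) :
    0 ≤ missProb cov x w := by
  rw [missProb_apply]
  exact Finset.sum_nonneg fun b _ => hw.1 b

theorem missProb_le_one (cov : B → Finset U) (x : U) {w : B → ℝ} (hw : w ∈ stdSimplex ℝ B) :
    missProb cov x w ≤ 1 := by
  rw [missProb_apply, ← hw.2]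
  exact Finset.sum_le_univ_sum_of_nonneg hw.1

theorem missProb_single [DecidableEq B] (cov : B → Finset U) (x : U) (b : B) :
    missProb cov x (Pi.single b 1) = if x ∈ cov b then 0 else 1 := by
  simp [missProb_apply, Pi.single_apply, Finset.sum_ite_eq']

theorem sum_missProb (cov : B → Finset U) (D : Finset U) (w : B → ℝ) :
    ∑ x ∈ D, missProb cov x w = ∑ b, w b * #(D \ cov b) := by
  simp only [missProb_apply, Finset.sum_filter]
  rw [Finset.sum_comm]
  refine Finset.sum_congr rfl fun b _ => ?_
  rw [← Finset.sum_filter, Finset.filter_notMem_eq_sdiff, Finset.sum_const, nsmul_eq_mul, mul_comm]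

theorem sum_inv_missProb_le {cov : B → Finset U} {w : B → ℝ} (hw : w ∈ stdSimplex ℝ B)
    {W D : Finset U} {b₀ : B} (hpos : ∀ x ∈ W, 0 < missProb cov x w)
    (hfair : ∑ x ∈ W \ cov b₀, (missProb cov x w)⁻¹ ≤ #W) (hD : D ⊆ W \ cov b₀) :
    ∑ x ∈ D, (missProb cov x w)⁻¹ ≤ #(cov b₀) + #D := by
  have hrest : (#((W \ cov b₀) \ D) : ℝ) ≤ ∑ x ∈ (W \ cov b₀) \ D, (missProb cov x w)⁻¹ := by
    rw [← nsmul_one]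
    refine Finset.card_nsmul_le_sum _ _ _ fun x hx => ?_
    have hxW : x ∈ W := (Finset.mem_sdiff.1 (Finset.mem_sdiff.1 hx).1).1
    exact (one_le_inv₀ (hpos x hxW)).2 (missProb_le_one cov x hw)
  have hW : (#W : ℝ) ≤ #(cov b₀) + #(W \ cov b₀) := by
    have := Finset.le_card_sdiff (cov b₀) W
    exact_mod_cast Nat.sub_le_iff_le_add'.1 this
  have hsplit : (#((W \ cov b₀) \ D) : ℝ) + #D = #(W \ cov b₀) := by
    exact_mod_cast Finset.card_sdiff_add_card_eq_card hD
  have := Finset.sum_sdiff (f := fun x => (missProb cov x w)⁻¹) hD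
  linarith

theorem exists_stdSimplex_sq_card_le [Nonempty B] [Finite U] (cov : B → Finset U) :
    ∃ w ∈ stdSimplex ℝ B, ∀ (b₀ : B) (D : Finset U), Disjoint D (cov b₀) →
      (#D : ℝ) ^ 2 ≤ (∑ b, w b * #(D \ cov b)) * (#(cov b₀) + #D) := by
  classical
  cases nonempty_fintype U
  let W : Finset U := {x | ∃ b, x ∉ cov b}
  have huniform : ∃ w ∈ stdSimplex ℝ B, ∀ x ∈ W, 0 < missProb cov x w := by
    refine ⟨fun _ => (Fintype.card B : ℝ)⁻¹, ⟨fun _ => by positivity, by simp⟩, fun x hx => ?_⟩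
    obtain ⟨b, hb⟩ := (Finset.mem_filter.1 hx).2
    rw [missProb_apply]
    exact Finset.sum_pos (fun _ _ => by positivity) ⟨b, by simpa using hb⟩
  obtain ⟨w, hw, hpos, hfair⟩ := exists_pos_forall_sum_div_le_card (isCompact_stdSimplex ℝ B)
    (convex_stdSimplex ℝ B) W (missProb cov) (fun x _ _ h => missProb_nonneg cov x h) huniform
  refine ⟨w, hw, fun b₀ D hD => ?_⟩
  have hDW : D ⊆ W \ cov b₀ := fun x hx => by
    have hxb := Finset.disjoint_left.1 hD hx
    exact Finset.mem_sdiff.2 ⟨Finset.mem_filter.2 ⟨Finset.mem_univ x, b₀, hxb⟩, hxb⟩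
  have hfair₀ : ∑ x ∈ W \ cov b₀, (missProb cov x w)⁻¹ ≤ #W := by
    simpa [missProb_single, ite_div, Finset.sum_ite, Finset.filter_notMem_eq_sdiff]
      using hfair _ (single_mem_stdSimplex ℝ b₀)
  have hpos_D : ∀ x ∈ D, 0 < missProb cov x w := fun x hx =>
    hpos x (Finset.mem_sdiff.1 (hDW hx)).1
  calc (#D : ℝ) ^ 2
      = (∑ x ∈ D, 1) ^ 2 := by simp
    _ ≤ (∑ x ∈ D, missProb cov x w) * ∑ x ∈ D, (missProb cov x w)⁻¹ :=
        Finset.sum_sq_le_sum_mul_sum_of_sq_le_mul D (fun x hx => (hpos_D x hx).le)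
          (fun x hx => inv_nonneg.2 (hpos_D x hx).le)
          fun x hx => by rw [one_pow, mul_inv_cancel₀ (hpos_D x hx).ne']
    _ ≤ (∑ b, w b * #(D \ cov b)) * (#(cov b₀) + #D) := by
        rw [← sum_missProb]
        exact mul_le_mul_of_nonneg_left (sum_inv_missProb_le hw hpos hfair₀ hDW)
          (Finset.sum_nonneg fun x hx => (hpos_D x hx).le)

/-- On the right, `∑ b, (q b).toReal * #(D \ cov b)` is the expected number of points of `D` that a
set drawn from `q` misses. -/
theorem exists_pmf_sq_card_le [Nonempty B] [Finite U] (cov : B → Finset U) :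
    ∃ q : PMF B, ∀ (b₀ : B) (D : Finset U), Disjoint D (cov b₀) →
      (#D : ℝ) ^ 2 ≤ (∑ b, (q b).toReal * #(D \ cov b)) * (#(cov b₀) + #D) := by
  obtain ⟨w, hw, hfair⟩ := exists_stdSimplex_sq_card_le cov
  refine ⟨PMF.ofFintype (fun b => ENNReal.ofReal (w b)) ?_, fun b₀ D hD => ?_⟩
  · rw [← ENNReal.ofReal_sum_of_nonneg fun b _ => hw.1 b, hw.2, ENNReal.ofReal_one]
  · simpa only [PMF.ofFintype_apply, ENNReal.toReal_ofReal (hw.1 _)] using hfair b₀ D hD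

end FairDistribution

section Matching

variable {V P U : Type*} {N : V → Finset U} {M M₀ M' : Finset (V × U)}

theorem IsMatching.injOn_fst (hM : IsMatching N M) : Set.InjOn Prod.fst (M : Set (V × U)) :=
  fun e he f hf h => hM.2 e he f hf (.inl h)

theorem IsMatching.injOn_snd (hM : IsMatching N M) : Set.InjOn Prod.snd (M : Set (V × U)) :=
  fun e he f hf h => hM.2 e he f hf (.inr h)

theorem IsMatching.mono (hM : IsMatching N M) (h : M' ⊆ M) : IsMatching N M' :=
  ⟨fun e he => hM.1 e (h he), fun e he f hf => hM.2 e (h he) f (h hf)⟩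

theorem IsMatching.insert [DecidableEq V] [DecidableEq U] {e : V × U} (hM : IsMatching N M)
    (he : e.2 ∈ N e.1) (hfree : ∀ f ∈ M, e.1 ≠ f.1 ∧ e.2 ≠ f.2) :
    IsMatching N (insert e M) := by
  refine ⟨Finset.forall_mem_insert .. |>.2 ⟨he, hM.1⟩, fun g hg f hf h => ?_⟩
  rcases Finset.mem_insert.1 hg with rfl | hg' <;> rcases Finset.mem_insert.1 hf with rfl | hf'
  · rfl
  · exact absurd h (not_or.2 (hfree f hf'))
  · exact absurd (h.imp Eq.symm Eq.symm) (not_or.2 (hfree g hg'))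
  · exact hM.2 g hg' f hf' h

/-- The offline nodes covered by a matching. -/
def covered [DecidableEq U] (M : Finset (V × U)) : Finset U :=
  M.image Prod.snd

theorem IsMatching.card_covered [DecidableEq U] (hM : IsMatching N M) : #(covered M) = #M :=
  Finset.card_image_of_injOn hM.injOn_snd

theorem isMatching_map (σ : P ↪ V) {B : Finset (P × U)} :
    IsMatching N (B.map (σ.prodMap (.refl U))) ↔ IsMatching (N ∘ σ) B := by
  simp only [IsMatching, Finset.forall_mem_map, Function.Embedding.coe_prodMap,
    Function.Embedding.refl_apply, Prod.map_fst, Prod.map_snd, Function.comp_apply, Prod.ext_iff,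
    σ.injective.eq_iff]

theorem map_filter_mem_prodMap [Fintype P] [Fintype U] [DecidableEq V] [DecidableEq U] (σ : P ↪ V)
    (M : Finset (V × U)) :
    ({b | σ.prodMap (.refl U) b ∈ M} : Finset (P × U)).map (σ.prodMap (.refl U)) =
      {e ∈ M | ∃ p, σ p = e.1} := by
  ext ⟨a, x⟩
  simp only [Finset.mem_map, Finset.mem_filter, Finset.mem_univ, true_and]
  constructor
  · rintro ⟨b, hb, he⟩
    exact ⟨he ▸ hb, b.1, congrArg Prod.fst he⟩
  · rintro ⟨h, p, rfl⟩
    exact ⟨(p, x), h, rfl⟩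

theorem exists_isMatching_card_eq [Fintype V] [Fintype U] (N : V → Finset U) :
    ∃ M, IsMatching N M ∧ #M = matchingNumber N := by
  classical
  obtain ⟨M, hM, hcard⟩ := Finset.exists_mem_eq_sup
    ({M | IsMatching N M} : Finset (Finset (V × U))) ⟨∅, by simp [IsMatching]⟩ Finset.card
  exact ⟨M, (Finset.mem_filter.1 hM).2, by rw [matchingNumber, ← hcard]⟩

variable [Fintype V] [Fintype U]

theorem IsMatching.card_le_matchingNumber (hM : IsMatching N M) : #M ≤ matchingNumber N := by
  classical
  exact Finset.le_sup (f := Finset.card) (Finset.mem_filter.2 ⟨Finset.mem_univ M, hM⟩)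

theorem exists_maximum_inter_ssubset [DecidableEq V] [DecidableEq U] (hM : IsMatching N M)
    (hcard : #M = matchingNumber N) (h₀ : IsMatching N M₀) {e : V × U} (he : e ∈ M₀)
    (hfree : ∀ f ∈ M, e.1 ≠ f.1) :
    ∃ M', IsMatching N M' ∧ #M' = matchingNumber N ∧ M ∩ M₀ ⊂ M' ∩ M₀ := by
  have heM : e ∉ M := fun h => hfree e h rfl
  obtain ⟨f, hf, hef⟩ : ∃ f ∈ M, e.2 = f.2 := by
    by_contra! hu
    have hle := (hM.insert (h₀.1 e he) fun f hf => ⟨hfree f hf, hu f hf⟩).card_le_matchingNumber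
    rw [Finset.card_insert_of_notMem heM] at hle
    omega
  have hf₀ : f ∉ M₀ := fun h => heM (h₀.2 e he f h (.inr hef) ▸ hf)
  have heE : e ∉ M.erase f := fun h => heM (Finset.mem_of_mem_erase h)
  refine ⟨insert e (M.erase f), (hM.mono (M.erase_subset f)).insert (h₀.1 e he) fun g hg => ?_,
    ?_, ?_⟩
  · obtain ⟨hgf, hg⟩ := Finset.mem_erase.1 hg
    exact ⟨hfree g hg, fun h => hgf (hM.2 g hg f hf (.inr (h.symm.trans hef)))⟩
  · rw [Finset.card_insert_of_notMem heE, Finset.card_erase_add_one hf, hcard]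
  · rw [Finset.insert_inter_of_mem he, Finset.erase_inter,
      Finset.erase_eq_of_notMem fun h => hf₀ (Finset.mem_inter.1 h).2]
    exact Finset.ssubset_insert fun h => heM (Finset.mem_inter.1 h).1

theorem IsMatching.exists_maximum_image_fst_subset [DecidableEq V] (h₀ : IsMatching N M₀) :
    ∃ M, IsMatching N M ∧ #M = matchingNumber N ∧ M₀.image Prod.fst ⊆ M.image Prod.fst := by
  classical
  -- A maximum matching with the most edges in common with `M₀` cannot be improved by an exchange.
  obtain ⟨M₁, hM₁⟩ := exists_isMatching_card_eq N
  obtain ⟨M, hM, hmax⟩ := Finset.exists_max_image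
    ({M | IsMatching N M ∧ #M = matchingNumber N} : Finset (Finset (V × U)))
    (fun M => #(M ∩ M₀)) ⟨M₁, Finset.mem_filter.2 ⟨Finset.mem_univ _, hM₁⟩⟩
  obtain ⟨hM, hcard⟩ := (Finset.mem_filter.1 hM).2
  refine ⟨M, hM, hcard, fun a ha => by_contra fun hno => ?_⟩
  obtain ⟨e, he, rfl⟩ := Finset.mem_image.1 ha
  obtain ⟨M', hM', hcard', hlt⟩ := exists_maximum_inter_ssubset hM hcard h₀ he
    fun f hf hef => hno (Finset.mem_image.2 ⟨f, hf, hef.symm⟩)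
  exact (hmax M' (Finset.mem_filter.2 ⟨Finset.mem_univ _, hM', hcard'⟩)).not_gt
    (Finset.card_lt_card hlt)

theorem exists_maximum_split [Fintype P] [DecidableEq U] (N : V → Finset U) (σ : P ↪ V) :
    ∃ (B : Finset (P × U)) (O : Finset (V × U)), IsMatching (N ∘ σ) B ∧
      #B = matchingNumber (N ∘ σ) ∧ IsMatching N O ∧ #B + #O = matchingNumber N ∧
      (∀ e ∈ O, ∀ p, σ p ≠ e.1) ∧ Disjoint (covered O) (covered B) := by
  classical
  set ι := σ.prodMap (.refl U)
  obtain ⟨B₀, hB₀, hB₀c⟩ := exists_isMatching_card_eq (N ∘ σ)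
  obtain ⟨M, hM, hMc, hcov⟩ := ((isMatching_map σ).2 hB₀).exists_maximum_image_fst_subset
  set B : Finset (P × U) := {b | ι b ∈ M}
  set O : Finset (V × U) := {e ∈ M | ¬ ∃ p, σ p = e.1}
  have hBM : B.map ι = {e ∈ M | ∃ p, σ p = e.1} := map_filter_mem_prodMap σ M
  have hB : IsMatching (N ∘ σ) B :=
    (isMatching_map σ).1 (hM.mono (hBM ▸ Finset.filter_subset _ _))
  have hle : #B₀ ≤ #B := by
    rw [← Finset.card_image_of_injOn hB₀.injOn_fst, ← Finset.card_image_of_injOn hB.injOn_fst]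
    refine Finset.card_le_card fun p hp => ?_
    obtain ⟨b, hb, rfl⟩ := Finset.mem_image.1 hp
    obtain ⟨⟨_, x⟩, hx, rfl⟩ := Finset.mem_image.1
      (hcov (Finset.mem_image_of_mem Prod.fst (Finset.mem_map_of_mem ι hb)))
    exact Finset.mem_image.2 ⟨(b.1, x), Finset.mem_filter.2 ⟨Finset.mem_univ _, hx⟩, rfl⟩
  refine ⟨B, O, hB, hB.card_le_matchingNumber.antisymm (hB₀c ▸ hle),
    hM.mono (Finset.filter_subset _ _), ?_,
    fun e he p hp => (Finset.mem_filter.1 he).2 ⟨p, hp⟩, ?_⟩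
  · rw [← hMc, ← Finset.card_map ι, hBM]
    exact Finset.card_filter_add_card_filter_not _
  · refine Finset.disjoint_left.2 fun x hxO hxB => ?_
    obtain ⟨e, he, rfl⟩ := Finset.mem_image.1 hxO
    obtain ⟨b, hb, hbe⟩ := Finset.mem_image.1 hxB
    obtain ⟨heM, heσ⟩ := Finset.mem_filter.1 he
    exact heσ ⟨b.1, congrArg Prod.fst (hM.2 _ (Finset.mem_filter.1 hb).2 e heM (.inr hbe))⟩

end Matching

section Argmin

variable {U K : Type*} [LinearOrder K] {k : U → K} {S T : Finset U} {u x : U}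

/-- An element of `S` of smallest key, `none` if `S` is empty. It is the greedy choice among the
free neighbours of an arriving node. -/
noncomputable def argmin (k : U → K) (S : Finset U) : Option U :=
  S.toList.argmin k

theorem mem_of_argmin_eq_some (h : argmin k S = some u) : u ∈ S :=
  Finset.mem_toList.1 (List.argmin_mem h)

theorem le_of_argmin_eq_some (h : argmin k S = some u) (hx : x ∈ S) : k u ≤ k x :=
  List.le_of_mem_argmin (Finset.mem_toList.2 hx) h

theorem exists_argmin_eq_some (k : U → K) (hx : x ∈ S) : ∃ u, argmin k S = some u :=
  Option.ne_none_iff_exists'.1 fun h =>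
    List.ne_nil_of_mem (Finset.mem_toList.2 hx) (List.argmin_eq_none.1 h)

theorem argmin_eq_some_iff (hk : k.Injective) :
    argmin k S = some u ↔ u ∈ S ∧ ∀ x ∈ S, k u ≤ k x := by
  refine ⟨fun h => ⟨mem_of_argmin_eq_some h, fun _ => le_of_argmin_eq_some h⟩, fun h => ?_⟩
  obtain ⟨z, hz⟩ := exists_argmin_eq_some k h.1
  rw [hz, hk ((le_of_argmin_eq_some hz h.1).antisymm (h.2 z (mem_of_argmin_eq_some hz)))]

theorem argmin_eq_some_of_subset (hk : k.Injective) (hST : S ⊆ T) (h : argmin k T = some u)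
    (hu : u ∈ S) : argmin k S = some u :=
  (argmin_eq_some_iff hk).2 ⟨hu, fun _ hx => le_of_argmin_eq_some h (hST hx)⟩

theorem argmin_erase [DecidableEq U] (hk : k.Injective) (h : argmin k S ≠ some x) :
    argmin k (S.erase x) = argmin k S := by
  rcases S.eq_empty_or_nonempty with rfl | ⟨y, hy⟩
  · rw [Finset.erase_empty]
  · obtain ⟨z, hz⟩ := exists_argmin_eq_some k hy
    have hzx : z ≠ x := fun e => h (e ▸ hz)
    rw [hz]
    exact argmin_eq_some_of_subset hk (S.erase_subset x) hz
      (Finset.mem_erase.2 ⟨hzx, mem_of_argmin_eq_some hz⟩)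

theorem argmin_congr {k' : U → K} (hk : k.Injective) (hk' : k'.Injective)
    (h : ∀ u ∈ S, k u = k' u) : argmin k S = argmin k' S := by
  ext u
  rw [argmin_eq_some_iff hk, argmin_eq_some_iff hk']
  refine and_congr_right fun hu => forall₂_congr fun x hx => ?_
  rw [h u hu, h x hx]

end Argmin

section Greedy

variable {V U : Type*} [DecidableEq V] [DecidableEq U]

/-- The free nodes that are left of `F` when an arriving node with neighbours `S` has been given
its choice. -/
def remaining (c : Finset U → Option U) (F S : Finset U) : Finset U :=
  {x ∈ F | c (F ∩ S) ≠ some x}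

/-- The greedy matching: every arriving node is given the choice `c` among its neighbours in the
set of free nodes, which initially is `F`. -/
def greedy (c : Finset U → Option U) (N : V → Finset U) : Finset U → List V → Finset (V × U)
  | _, [] => ∅
  | F, v :: vs =>
    (c (F ∩ N v)).toFinset.map (.sectR v U) ∪ greedy c N (remaining c F (N v)) vs

variable {c : Finset U → Option U} {N : V → Finset U} {F F' : Finset U} {v a : V} {vs : List V}
  {d x y : U}

theorem mem_remaining {S : Finset U} : x ∈ remaining c F S ↔ x ∈ F ∧ c (F ∩ S) ≠ some x :=
  Finset.mem_filter

theorem remaining_subset (c : Finset U → Option U) (F S : Finset U) : remaining c F S ⊆ F :=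
  Finset.filter_subset _ _

theorem mem_greedy_cons : (a, x) ∈ greedy c N F (v :: vs) ↔
    (a = v ∧ c (F ∩ N v) = some x) ∨ (a, x) ∈ greedy c N (remaining c F (N v)) vs := by
  simp only [greedy, Finset.mem_union, Finset.mem_map, Option.mem_toFinset, Option.mem_def,
    Function.Embedding.sectR_apply, Prod.mk.injEq]
  aesop

section Choice

variable (hc : ∀ S x, c S = some x → x ∈ S)
include hc

theorem mem_of_mem_greedy (h : (a, x) ∈ greedy c N F vs) : a ∈ vs ∧ x ∈ F ∧ x ∈ N a := by
  induction vs generalizing F with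
  | nil => simp [greedy] at h
  | cons v vs ih =>
    rcases mem_greedy_cons.1 h with ⟨rfl, h⟩ | h
    · exact ⟨List.mem_cons_self, Finset.mem_inter.1 (hc _ _ h)⟩
    · obtain ⟨ha, hx, hxa⟩ := ih h
      exact ⟨List.mem_cons_of_mem _ ha, remaining_subset _ _ _ hx, hxa⟩

theorem eq_of_mem_greedy_right {b : V} (ha : (a, x) ∈ greedy c N F vs)
    (hb : (b, x) ∈ greedy c N F vs) : a = b := by
  induction vs generalizing F with
  | nil => simp [greedy] at ha
  | cons v vs ih =>
    have hnew {a} (h : (a, x) ∈ greedy c N (remaining c F (N v)) vs) : c (F ∩ N v) ≠ some x :=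
      (mem_remaining.1 (mem_of_mem_greedy hc h).2.1).2
    rcases mem_greedy_cons.1 ha with ⟨rfl, ha⟩ | ha <;>
      rcases mem_greedy_cons.1 hb with ⟨rfl, hb⟩ | hb
    · rfl
    · exact absurd ha (hnew hb)
    · exact absurd hb (hnew ha)
    · exact ih ha hb

theorem eq_of_mem_greedy_left (hvs : vs.Nodup) (hx : (a, x) ∈ greedy c N F vs)
    (hy : (a, y) ∈ greedy c N F vs) : x = y := by
  induction vs generalizing F with
  | nil => simp [greedy] at hx
  | cons v vs ih =>
    obtain ⟨hv, hvs⟩ := List.nodup_cons.1 hvs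
    rcases mem_greedy_cons.1 hx with ⟨rfl, hx⟩ | hx <;>
      rcases mem_greedy_cons.1 hy with ⟨hav, hy⟩ | hy
    · exact Option.some_injective _ (hx.symm.trans hy)
    · exact absurd (mem_of_mem_greedy hc hy).1 hv
    · exact absurd (hav ▸ (mem_of_mem_greedy hc hx).1) hv
    · exact ih hvs hx hy

end Choice

theorem greedy_congr {c' : Finset U → Option U} (hcc' : ∀ S, d ∉ S → c S = c' S) (hd : d ∉ F) :
    greedy c N F vs = greedy c' N F vs := by
  induction vs generalizing F with
  | nil => rfl
  | cons v vs ih =>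
    have hv : c (F ∩ N v) = c' (F ∩ N v) := hcc' _ fun h => hd (Finset.mem_inter.1 h).1
    have hrem : remaining c F (N v) = remaining c' F (N v) := by rw [remaining, hv, remaining]
    rw [greedy, greedy, hv, hrem, ih fun h => hd (remaining_subset _ _ _ h)]

section Key

variable {K : Type*} [LinearOrder K] {k : U → K} (hk : k.Injective)
include hk

theorem remaining_argmin_mono (hF : F ⊆ F') (S : Finset U) :
    remaining (argmin k) F S ⊆ remaining (argmin k) F' S := by
  intro x hx
  obtain ⟨hxF, hne⟩ := mem_remaining.1 hx
  refine mem_remaining.2 ⟨hF hxF, fun h => hne ?_⟩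
  have hxS : x ∈ S := (Finset.mem_inter.1 (mem_of_argmin_eq_some h)).2
  exact argmin_eq_some_of_subset hk (Finset.inter_subset_inter_right hF) h
    (Finset.mem_inter.2 ⟨hxF, hxS⟩)

theorem exists_mem_greedy_of_subset (hF : F ⊆ F') (h : (a, x) ∈ greedy (argmin k) N F vs) :
    ∃ z, (a, z) ∈ greedy (argmin k) N F' vs ∧ k z ≤ k x := by
  induction vs generalizing F F' with
  | nil => simp [greedy] at h
  | cons v vs ih =>
    rcases mem_greedy_cons.1 h with ⟨rfl, h⟩ | h
    · have hx : x ∈ F' ∩ N a := Finset.inter_subset_inter_right hF (mem_of_argmin_eq_some h)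
      obtain ⟨z, hz⟩ := exists_argmin_eq_some k hx
      exact ⟨z, mem_greedy_cons.2 (.inl ⟨rfl, hz⟩), le_of_argmin_eq_some hz hx⟩
    · obtain ⟨z, hz, hzx⟩ := ih (remaining_argmin_mono hk hF (N v)) h
      exact ⟨z, mem_greedy_cons.2 (.inr hz), hzx⟩

theorem greedy_erase_of_unmatched (hd : ∀ a, (a, d) ∉ greedy (argmin k) N F vs) :
    greedy (argmin k) N (F.erase d) vs = greedy (argmin k) N F vs := by
  induction vs generalizing F with
  | nil => rfl
  | cons v vs ih =>
    have hv : argmin k (F.erase d ∩ N v) = argmin k (F ∩ N v) := by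
      rw [Finset.erase_inter]
      exact argmin_erase hk fun h => hd v (mem_greedy_cons.2 (.inl ⟨rfl, h⟩))
    have hrem : remaining (argmin k) (F.erase d) (N v) =
        (remaining (argmin k) F (N v)).erase d := by
      rw [remaining, hv, Finset.filter_erase, remaining]
    rw [greedy, greedy, hv, hrem, ih fun a ha => hd a (mem_greedy_cons.2 (.inr ha))]

end Key

theorem exists_mem_greedy_of_unmatched {K : Type*} [LinearOrder K] {k : U → K}
    (hd : ∀ a, (a, d) ∉ greedy (argmin k) N F vs) (hdF : d ∈ F) (ha : a ∈ vs) (hda : d ∈ N a) :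
    ∃ z, (a, z) ∈ greedy (argmin k) N F vs ∧ k z ≤ k d := by
  induction vs generalizing F with
  | nil => simp at ha
  | cons v vs ih =>
    rcases List.mem_cons.1 ha with rfl | ha
    · have hd' : d ∈ F ∩ N a := Finset.mem_inter.2 ⟨hdF, hda⟩
      obtain ⟨z, hz⟩ := exists_argmin_eq_some k hd'
      exact ⟨z, mem_greedy_cons.2 (.inl ⟨rfl, hz⟩), le_of_argmin_eq_some hz hd'⟩
    · have hdR : d ∈ remaining (argmin k) F (N v) :=
        mem_remaining.2 ⟨hdF, fun h => hd v (mem_greedy_cons.2 (.inl ⟨rfl, h⟩))⟩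
      obtain ⟨z, hz, hzd⟩ := ih (fun a ha => hd a (mem_greedy_cons.2 (.inr ha))) hdR ha
      exact ⟨z, mem_greedy_cons.2 (.inr hz), hzd⟩

end Greedy

section EdgeGain

theorem sum_sum_filter_le_sum {ι κ γ : Type*} [DecidableEq γ] {O : Finset ι} {M : Finset κ}
    {φ : ι → γ} (ψ : κ → γ) {g : κ → ℝ} (hφ : Set.InjOn φ O) (hg : ∀ e ∈ M, 0 ≤ g e) :
    ∑ f ∈ O, ∑ e ∈ M with ψ e = φ f, g e ≤ ∑ e ∈ M, g e := by
  rw [← Finset.sum_image (f := fun z => ∑ e ∈ M with ψ e = z, g e) hφ]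
  exact Finset.sum_fiberwise_le_sum_of_sum_fiber_nonneg fun z _ =>
    Finset.sum_nonneg fun e he => hg e (Finset.mem_filter.1 he).1

variable {V U : Type*} [DecidableEq V] [DecidableEq U] {p : U → ℝ} {M O : Finset (V × U)}

/-- Every pair of `M` has value `1`, of which its offline end `x` receives `p x` and its online end
the rest. The gain of an edge `f` is what the two ends of `f` receive together. -/
noncomputable def edgeGain (p : U → ℝ) (M : Finset (V × U)) (f : V × U) : ℝ :=
  ∑ e ∈ M with e.2 = f.2, p e.2 + ∑ e ∈ M with e.1 = f.1, (1 - p e.2)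

variable (hp₀ : ∀ x, 0 ≤ p x) (hp₁ : ∀ x, p x ≤ 1)
include hp₀ hp₁

theorem edgeGain_nonneg (M : Finset (V × U)) (f : V × U) : 0 ≤ edgeGain p M f :=
  add_nonneg (Finset.sum_nonneg fun e _ => hp₀ e.2)
    (Finset.sum_nonneg fun e _ => sub_nonneg.2 (hp₁ e.2))

theorem sum_edgeGain_le_card (M : Finset (V × U)) (hO₁ : Set.InjOn Prod.fst (O : Set (V × U)))
    (hO₂ : Set.InjOn Prod.snd (O : Set (V × U))) : ∑ f ∈ O, edgeGain p M f ≤ #M :=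
  calc ∑ f ∈ O, edgeGain p M f
      ≤ ∑ e ∈ M, p e.2 + ∑ e ∈ M, (1 - p e.2) := by
        simp only [edgeGain, Finset.sum_add_distrib]
        exact add_le_add (sum_sum_filter_le_sum Prod.snd hO₂ fun e _ => hp₀ e.2)
          (sum_sum_filter_le_sum Prod.fst hO₁ fun e _ => sub_nonneg.2 (hp₁ e.2))
    _ = #M := by simp

theorem edgeGain_le_card (M : Finset (V × U)) (f : V × U) : edgeGain p M f ≤ #M := by
  simpa using sum_edgeGain_le_card (O := {f}) hp₀ hp₁ M (by simp) (by simp)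

theorem ite_add_le_edgeGain {a : V} {d : U} {Q : Prop} [Decidable Q] {r : ℝ}
    (hd : Q → ∃ b, (b, d) ∈ M) (ha : r = 1 ∨ ∃ x, (a, x) ∈ M ∧ p x ≤ r) :
    (if Q then p d else 0) + (1 - r) ≤ edgeGain p M (a, d) := by
  refine add_le_add ?_ ?_
  · split_ifs with hQ
    · obtain ⟨b, hb⟩ := hd hQ
      exact Finset.single_le_sum (f := fun e : V × U => p e.2) (fun e _ => hp₀ e.2)
        (Finset.mem_filter.2 ⟨hb, rfl⟩ : (b, d) ∈ M.filter (·.2 = d))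
    · exact Finset.sum_nonneg fun e _ => hp₀ e.2
  · have hnonneg : ∀ e ∈ M.filter (·.1 = a), 0 ≤ 1 - p e.2 := fun e _ => sub_nonneg.2 (hp₁ e.2)
    rcases ha with rfl | ⟨x, hx, hxr⟩
    · simpa using Finset.sum_nonneg hnonneg
    · exact (sub_le_sub_left hxr 1).trans <|
        Finset.single_le_sum hnonneg (Finset.mem_filter.2 ⟨hx, rfl⟩)

end EdgeGain

theorem le_integral_pi_of_forall_le_integral_update {ι : Type*} {X : ι → Type*} [Fintype ι]
    [DecidableEq ι] [∀ i, MeasurableSpace (X i)] {μ : ∀ i, Measure (X i)}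
    [∀ i, IsProbabilityMeasure (μ i)] {f : (∀ i, X i) → ℝ} (hfm : Measurable f)
    (hf : Integrable f (Measure.pi μ)) (h₀ : ∀ x, 0 ≤ f x) (i : ι) {c : ℝ}
    (hc : ∀ x, c ≤ ∫ t, f (Function.update x i t) ∂μ i) : c ≤ ∫ x, f x ∂Measure.pi μ := by
  rw [← ENNReal.ofReal_le_ofReal_iff (integral_nonneg h₀),
    ofReal_integral_eq_lintegral_ofReal hf (.of_forall h₀)]
  calc ENNReal.ofReal c = ∫⁻ _, ENNReal.ofReal c ∂Measure.pi μ := by simp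
    _ ≤ ∫⁻ x, ENNReal.ofReal (f x) ∂Measure.pi μ := by
      refine lintegral_le_of_lmarginal_le {i} measurable_const hfm.ennreal_ofReal fun x => ?_
      rw [lmarginal_singleton, lmarginal_singleton]
      simp only [lintegral_const, measure_univ, mul_one]
      refine (ENNReal.ofReal_le_ofReal (hc x)).trans ?_
      rw [integral_eq_lintegral_of_nonneg_ae (.of_forall fun t => h₀ _)
        (hfm.comp (measurable_update x)).aestronglyMeasurable]
      exact ENNReal.ofReal_toReal_le

section Ranking

open scoped unitInterval

variable {V U : Type*} [Fintype U]

/-- The rank of the offline node `u` under the labels `y`; equal labels are told apart by an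
enumeration of `U`. -/
noncomputable def rankKey (y : U → I) (u : U) : I ×ₗ Fin (Fintype.card U) :=
  toLex (y u, Fintype.equivFin U u)

theorem rankKey_injective (y : U → I) : (rankKey y).Injective := fun _ _ h =>
  (Fintype.equivFin U).injective (congrArg Prod.snd (toLex.injective h))

theorem label_le_of_rankKey_le {y : U → I} {u x : U} (h : rankKey y u ≤ rankKey y x) :
    y u ≤ y x :=
  Prod.Lex.monotone_fst _ _ h

/-- The choice of RANKING among a set of free neighbours: the one with the smallest label. -/
noncomputable abbrev rankChoice (y : U → I) : Finset U → Option U :=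
  argmin (rankKey y)

theorem measurableSet_rankChoice_eq (S : Finset U) (o : Option U) :
    MeasurableSet {y : U → I | rankChoice y S = o} := by
  have hkey (u x : U) : Measurable fun y : U → I => rankKey y u ≤ rankKey y x := by
    simp only [rankKey, Prod.Lex.toLex_le_toLex]
    exact .or (measurableSet_lt (measurable_pi_apply u) (measurable_pi_apply x)).mem
      (.and (measurableSet_eq_fun (measurable_pi_apply u) (measurable_pi_apply x)).mem
        measurable_const)
  have hsome (u : U) : Measurable fun y : U → I => rankChoice y S = some u := by
    simp only [argmin_eq_some_iff (rankKey_injective _)]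
    exact .and measurable_const (.forall fun x => .imp measurable_const (hkey u x))
  refine measurableSet_setOfPred.2 ?_
  cases o with
  | some u => exact hsome u
  | none =>
    simp only [Option.eq_none_iff_forall_ne_some]
    exact .forall fun u => (hsome u).not

theorem measurable_rankChoice : Measurable[_, ⊤] (rankChoice : (U → I) → Finset U → Option U) := by
  let _ : MeasurableSpace (Finset U → Option U) := ⊤
  classical
  refine measurable_to_countable' fun c => ?_
  have : rankChoice ⁻¹' {c} = ⋂ S, {y : U → I | rankChoice y S = c S} := by
    ext y
    simp [funext_iff]
  rw [this]
  exact .iInter fun S => measurableSet_rankChoice_eq S (c S)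

theorem measurable_apply_rankChoice {g : (Finset U → Option U) → (U → I) → ℝ}
    (hg : ∀ c, Measurable (g c)) : Measurable fun y => g (rankChoice y) y := by
  let _ : MeasurableSpace (Finset U → Option U) := ⊤
  classical
  exact (measurable_from_prod_countable_right (f := fun z => g z.1 z.2) hg).comp
    (measurable_rankChoice.prodMk measurable_id)

theorem integrable_comp_rankChoice (g : (Finset U → Option U) → ℝ) :
    Integrable fun y : U → I => g (rankChoice y) := by
  let _ : MeasurableSpace (Finset U → Option U) := ⊤
  classical
  exact Integrable.of_finite.comp_measurable (g := g) measurable_rankChoice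

variable [DecidableEq V] [DecidableEq U] {N : V → Finset U} {F : Finset U} {vs : List V} {a : V}
  {d : U}

theorem greedy_rankChoice_update_erase (y : U → I) (t : I) :
    greedy (rankChoice (Function.update y d t)) N (F.erase d) vs =
      greedy (rankChoice y) N (F.erase d) vs :=
  greedy_congr (fun S hS => argmin_congr (rankKey_injective _) (rankKey_injective _) fun u hu => by
    simp [rankKey, ne_of_mem_of_not_mem hu hS]) (Finset.notMem_erase d F)

/-- The threshold `γ` is the label of the partner of `a` when `d` is removed from the graph. -/
theorem exists_threshold (hd : d ∈ F) (ha : a ∈ vs) (hda : d ∈ N a) (y : U → I) :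
    ∃ γ : I, ∀ t : I,
      (t < γ → ∃ b, (b, d) ∈ greedy (rankChoice (Function.update y d t)) N F vs) ∧
      (γ = 1 ∨ ∃ x, (a, x) ∈ greedy (rankChoice (Function.update y d t)) N F vs ∧
        Function.update y d t x ≤ γ) := by
  set G := greedy (rankChoice y) N (F.erase d) vs with hG
  have hG_ne {b x} (h : (b, x) ∈ G) : x ≠ d :=
    (Finset.mem_erase.1 (mem_of_mem_greedy (fun _ _ => mem_of_argmin_eq_some) h).2.1).1
  let T : Finset (V × U) := {e ∈ G | e.1 = a}
  refine ⟨T.inf fun e => y e.2, fun t => ⟨fun ht => ?_, ?_⟩⟩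
  · by_contra! hfree
    obtain ⟨z, hz, hzd⟩ := exists_mem_greedy_of_unmatched hfree hd ha hda
    rw [← greedy_erase_of_unmatched (rankKey_injective _) hfree,
      greedy_rankChoice_update_erase] at hz
    have hzt := label_le_of_rankKey_le hzd
    rw [Function.update_of_ne (hG_ne hz), Function.update_self] at hzt
    have hzT : (a, z) ∈ T := Finset.mem_filter.2 ⟨hz, rfl⟩
    exact ht.not_ge ((Finset.inf_le (f := fun e => y e.2) hzT).trans hzt)
  · rcases T.eq_empty_or_nonempty with hT | hT
    · exact .inl (by rw [hT, Finset.inf_empty]; rfl)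
    · right
      obtain ⟨⟨b, x⟩, hx, hγ⟩ := Finset.exists_mem_eq_inf T hT fun e => y e.2
      obtain ⟨hxG, rfl⟩ := Finset.mem_filter.1 hx
      have hmem := hxG
      rw [hG, ← greedy_rankChoice_update_erase y t] at hmem
      obtain ⟨z, hz, hzx⟩ := exists_mem_greedy_of_subset (rankKey_injective _)
        (F.erase_subset d) hmem
      refine ⟨z, hz, (label_le_of_rankKey_le hzx).trans ?_⟩
      rw [Function.update_of_ne (hG_ne hxG), hγ]

/-- The share of the value of a pair that its offline end receives when it has label `t`. -/
noncomputable def price (t : I) : ℝ :=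
  Real.exp (t - 1)

theorem price_nonneg (t : I) : 0 ≤ price t :=
  (Real.exp_pos _).le

theorem price_mono : Monotone price := fun _ _ h =>
  Real.exp_le_exp.2 (sub_le_sub_right (Subtype.coe_le_coe.2 h) 1)

theorem price_one : price 1 = 1 := by
  simp [price]

theorem price_le_one (t : I) : price t ≤ 1 :=
  (price_mono t.2.2).trans_eq price_one

theorem continuous_price : Continuous price := by
  unfold price
  fun_prop

theorem integral_ite_lt (f : ℝ → ℝ) (γ : I) :
    ∫ t : I, (if t < γ then f t else 0) = ∫ t in (0 : ℝ)..γ, f t := by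
  have hinter : Set.Icc 0 1 ∩ Set.Iio (γ : ℝ) = Set.Ico 0 (γ : ℝ) := by
    ext t
    exact ⟨fun h => ⟨h.1.1, h.2⟩, fun h => ⟨⟨h.1, h.2.le.trans γ.2.2⟩, h.2⟩⟩
  calc ∫ t : I, (if t < γ then f t else 0)
      = ∫ t in Set.Icc 0 1, (Set.Iio (γ : ℝ)).indicator f t :=
          integral_subtype measurableSet_Icc ((Set.Iio (γ : ℝ)).indicator f)
    _ = ∫ t in (0 : ℝ)..γ, f t := by
      rw [setIntegral_indicator measurableSet_Iio, hinter, integral_Ico_eq_integral_Ioc,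
        intervalIntegral.integral_of_le γ.2.1]

/-- `exp (t - 1)` is the solution of the differential equation that makes this independent
of `γ`. -/
theorem integral_ite_price_add (γ : I) :
    ∫ t : I, ((if t < γ then price t else 0) + (1 - price γ)) = 1 - 1 / Real.exp 1 := by
  have hint_ite : Integrable (fun t : I => if t < γ then price t else 0) := by
    refine .of_mem_Icc 0 1 (Measurable.ite measurableSet_Iio continuous_price.measurable
      measurable_const).aemeasurable (.of_forall fun t => ?_)
    split_ifs <;> simp [price_nonneg, price_le_one]
  have hshare : ∫ t : I, (if t < γ then price t else 0) = price γ - 1 / Real.exp 1 :=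
    calc ∫ t : I, (if t < γ then price t else 0)
        = ∫ t in (0 : ℝ)..γ, Real.exp (t - 1) := integral_ite_lt (fun t => Real.exp (t - 1)) γ
      _ = price γ - 1 / Real.exp 1 := by
        rw [intervalIntegral.integral_comp_sub_right, integral_exp]
        simp [price, Real.exp_neg]
  rw [integral_add hint_ite (integrable_const _), integral_const, probReal_univ, one_smul, hshare]
  ring

theorem measurable_edgeGain_greedy (f : V × U) : Measurable fun y : U → I =>
    edgeGain (price ∘ y) (greedy (rankChoice y) N F vs) f := by
  refine measurable_apply_rankChoice (g := fun c y => edgeGain (price ∘ y) (greedy c N F vs) f)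
    fun c => ?_
  have hprice (x : U) : Measurable fun y : U → I => price (y x) :=
    continuous_price.measurable.comp (measurable_pi_apply x)
  simp only [edgeGain, Function.comp_apply]
  fun_prop

theorem edgeGain_greedy_mem_Icc (y : U → I) (f : V × U) :
    edgeGain (price ∘ y) (greedy (rankChoice y) N F vs) f ∈
      Set.Icc (0 : ℝ) #(vs.toFinset ×ˢ F) := by
  have hsub : greedy (rankChoice y) N F vs ⊆ vs.toFinset ×ˢ F := fun e he => by
    have := mem_of_mem_greedy (fun _ _ => mem_of_argmin_eq_some) he
    exact Finset.mem_product.2 ⟨List.mem_toFinset.2 this.1, this.2.1⟩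
  have h₀ (x : U) : 0 ≤ (price ∘ y) x := price_nonneg _
  have h₁ (x : U) : (price ∘ y) x ≤ 1 := price_le_one _
  exact ⟨edgeGain_nonneg h₀ h₁ _ f, (edgeGain_le_card h₀ h₁ _ f).trans
    (by exact_mod_cast Finset.card_le_card hsub)⟩

theorem integrable_edgeGain_greedy (f : V × U) : Integrable fun y : U → I =>
    edgeGain (price ∘ y) (greedy (rankChoice y) N F vs) f :=
  .of_mem_Icc 0 _ (measurable_edgeGain_greedy f).aemeasurable
    (.of_forall fun y => edgeGain_greedy_mem_Icc y f)

theorem one_sub_inv_exp_le_integral_edgeGain_update (hd : d ∈ F) (ha : a ∈ vs) (hda : d ∈ N a)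
    (y : U → I) : 1 - 1 / Real.exp 1 ≤ ∫ t : I, edgeGain (price ∘ Function.update y d t)
      (greedy (rankChoice (Function.update y d t)) N F vs) (a, d) := by
  obtain ⟨γ, hγ⟩ := exists_threshold hd ha hda y
  rw [← integral_ite_price_add γ]
  refine integral_mono_of_nonneg (.of_forall fun t => ?_) (.of_mem_Icc 0 _
    ((measurable_edgeGain_greedy (a, d)).comp (measurable_update y)).aemeasurable
    (.of_forall fun t => edgeGain_greedy_mem_Icc _ _)) (.of_forall fun t => ?_)
  · exact add_nonneg (by split_ifs <;> simp [price_nonneg]) (sub_nonneg.2 (price_le_one γ))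
  · have := ite_add_le_edgeGain (p := price ∘ Function.update y d t) (fun _ => price_nonneg _)
      (fun _ => price_le_one _) (hγ t).1 ((hγ t).2.imp (fun h => by rw [h, price_one])
        fun ⟨x, hx, hxγ⟩ => ⟨x, hx, price_mono hxγ⟩)
    simpa using this

theorem one_sub_inv_exp_le_integral_edgeGain (hd : d ∈ F) (ha : a ∈ vs) (hda : d ∈ N a) :
    1 - 1 / Real.exp 1 ≤
      ∫ y : U → I, edgeGain (price ∘ y) (greedy (rankChoice y) N F vs) (a, d) :=
  le_integral_pi_of_forall_le_integral_update (measurable_edgeGain_greedy (a, d))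
    (integrable_edgeGain_greedy _) (fun y => (edgeGain_greedy_mem_Icc y (a, d)).1) d
    (one_sub_inv_exp_le_integral_edgeGain_update hd ha hda)

theorem le_integral_card_greedy_rankChoice {O : Finset (V × U)} (hO : IsMatching N O)
    (hOF : ∀ e ∈ O, e.1 ∈ vs ∧ e.2 ∈ F) : (1 - 1 / Real.exp 1) * #O ≤
      ∫ y : U → I, (#(greedy (rankChoice y) N F vs) : ℝ) :=
  calc (1 - 1 / Real.exp 1) * #O
      = ∑ f ∈ O, (1 - 1 / Real.exp 1) := by rw [Finset.sum_const, nsmul_eq_mul, mul_comm]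
    _ ≤ ∑ f ∈ O, ∫ y : U → I, edgeGain (price ∘ y) (greedy (rankChoice y) N F vs) f :=
      Finset.sum_le_sum fun f hf =>
        one_sub_inv_exp_le_integral_edgeGain (hOF f hf).2 (hOF f hf).1 (hO.1 f hf)
    _ = ∫ y : U → I, ∑ f ∈ O, edgeGain (price ∘ y) (greedy (rankChoice y) N F vs) f :=
      (integral_finsetSum O fun f _ => integrable_edgeGain_greedy f).symm
    _ ≤ ∫ y : U → I, (#(greedy (rankChoice y) N F vs) : ℝ) :=
      integral_mono (integrable_finsetSum _ fun f _ => integrable_edgeGain_greedy f)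
        (integrable_comp_rankChoice (fun c => (#(greedy c N F vs) : ℝ)))
        fun y => sum_edgeGain_le_card (fun _ => price_nonneg _)
          (fun _ => price_le_one _) _ hO.injOn_fst hO.injOn_snd

/-- The law of the choice function of RANKING with independent uniform labels. -/
noncomputable def rankingLaw (U : Type*) [Fintype U] :
    PMF (Finset U → Option U) :=
  letI : MeasurableSpace (Finset U → Option U) := ⊤
  haveI : IsProbabilityMeasure ((volume : Measure (U → I)).map rankChoice) :=
    Measure.isProbabilityMeasure_map measurable_rankChoice.aemeasurable
  ((volume : Measure (U → I)).map rankChoice).toPMF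

theorem sum_rankingLaw_mul (g : (Finset U → Option U) → ℝ) :
    ∑ c, (rankingLaw U c).toReal * g c = ∫ y : U → I, g (rankChoice y) := by
  let _ : MeasurableSpace (Finset U → Option U) := ⊤
  have _ : IsProbabilityMeasure ((volume : Measure (U → I)).map rankChoice) :=
    Measure.isProbabilityMeasure_map measurable_rankChoice.aemeasurable
  rw [← integral_map measurable_rankChoice.aemeasurable
    (measurable_of_finite g).aestronglyMeasurable, ← Measure.toPMF_toMeasure (.map _ _),
    PMF.integral_eq_sum]
  rfl

end Ranking

section Offers

variable {V U : Type*} {N : V → Finset U} {C : Finset (V × U)} {v : V} {vs : List V} {x : U}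

theorem mem_step_some (hx : x ∈ N v) (hfree : ∀ e ∈ C, e.2 ≠ x) {e : V × U} :
    e ∈ step N C v (some x) ↔ e = (v, x) ∨ e ∈ C := by
  classical
  rw [step, if_pos ⟨hx, hfree⟩]
  exact Finset.mem_insert

variable [DecidableEq V] [DecidableEq U]

/-- The edges that the strategy `A` asks for when the nodes `vs` arrive after history `h`, whether
or not their offline end is still free. -/
def offers (A : OnlineStrategy U) (N : V → Finset U) : List (Finset U) → List V → Finset (V × U)
  | _, [] => ∅
  | h, v :: vs => (A h (N v)).toFinset.map (.sectR v U) ∪ offers A N (h ++ [N v]) vs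

variable {A : OnlineStrategy U} {h : List (Finset U)} {a : V}

theorem mem_offers_cons : (a, x) ∈ offers A N h (v :: vs) ↔
    (a = v ∧ A h (N v) = some x) ∨ (a, x) ∈ offers A N (h ++ [N v]) vs := by
  simp only [offers, Finset.mem_union, Finset.mem_map, Option.mem_toFinset, Option.mem_def,
    Function.Embedding.sectR_apply, Prod.mk.injEq]
  aesop

theorem mem_of_mem_offers (hax : (a, x) ∈ offers A N h vs) : a ∈ vs := by
  induction vs generalizing h with
  | nil => simp [offers] at hax
  | cons v vs ih =>
    rcases mem_offers_cons.1 hax with ⟨rfl, -⟩ | hax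
    exacts [List.mem_cons_self, List.mem_cons_of_mem _ (ih hax)]

theorem runFrom_eq_union_offers (hvs : vs.Nodup) (hN : ∀ e ∈ offers A N h vs, e.2 ∈ N e.1)
    (hinj : Set.InjOn Prod.snd (offers A N h vs : Set (V × U)))
    (hC : ∀ e ∈ C, ∀ f ∈ offers A N h vs, e.2 ≠ f.2) :
    runFrom A N h C vs = C ∪ offers A N h vs := by
  induction vs generalizing h C with
  | nil => simp [runFrom, offers]
  | cons v vs ih =>
    obtain ⟨hv, hvs⟩ := List.nodup_cons.1 hvs
    have hsub : offers A N (h ++ [N v]) vs ⊆ offers A N h (v :: vs) := Finset.subset_union_right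
    have hstep {e} : e ∈ step N C v (A h (N v)) ↔
        (e.1 = v ∧ A h (N v) = some e.2) ∨ e ∈ C := by
      cases hx : A h (N v) with
      | none => simp [step]
      | some x =>
        have hvx : (v, x) ∈ offers A N h (v :: vs) := mem_offers_cons.2 (.inl ⟨rfl, hx⟩)
        rw [mem_step_some (hN _ hvx) fun e he => hC e he _ hvx, Prod.ext_iff, Option.some_inj,
          eq_comm (a := x)]
    rw [runFrom, ih hvs (fun e he => hN e (hsub he)) (hinj.mono (Finset.coe_subset.2 hsub))]
    · ext ⟨a, x⟩
      rw [Finset.mem_union, Finset.mem_union, hstep, mem_offers_cons]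
      tauto
    · intro e he f hf hef
      rcases hstep.1 he with ⟨rfl, hx⟩ | he
      · have heq := hinj (mem_offers_cons.2 (.inl ⟨rfl, hx⟩)) (hsub hf) hef
        exact hv (mem_of_mem_offers (heq ▸ hf))
      · exact hC e he f (hsub hf) hef

end Offers

section Abandoned

variable {V U : Type*} {c : Finset U → Option U} {N : V → Finset U} {F : Finset U} {v : V}
  {vs : List V}

variable [DecidableEq U]

/-- The arrivals that the greedy matching leaves unmatched. -/
def abandoned (c : Finset U → Option U) (N : V → Finset U) : Finset U → List V → List V
  | _, [] => []
  | F, v :: vs =>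
    if c (F ∩ N v) = none then v :: abandoned c N (remaining c F (N v)) vs
    else abandoned c N (remaining c F (N v)) vs

theorem mem_abandoned_or_exists_mem_greedy [DecidableEq V] (c : Finset U → Option U)
    (N : V → Finset U) (F : Finset U) (hv : v ∈ vs) :
    v ∈ abandoned c N F vs ∨ ∃ x, (v, x) ∈ greedy c N F vs := by
  induction vs generalizing F with
  | nil => simp at hv
  | cons a vs ih =>
    simp only [abandoned, mem_greedy_cons]
    rcases List.mem_cons.1 hv with rfl | hv
    · cases hx : c (F ∩ N v) with
      | none => simp
      | some x => exact .inr ⟨x, .inl ⟨rfl, rfl⟩⟩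
    · refine (ih (remaining c F (N a)) hv).imp (fun h => ?_) fun ⟨x, hx⟩ => ⟨x, .inr hx⟩
      split_ifs
      exacts [List.mem_cons_of_mem _ h, h]

end Abandoned

section Identification

variable {V P U : Type*} [Fintype P] [DecidableEq U] {H : P → Finset U}
  {N : V → Finset U} {vs : List V}

/-- The predicted nodes with the neighbours `S`. An arriving node with neighbours `S` could be any
of these, as far as the algorithm can tell. -/
def lookalikes (H : P → Finset U) (S : Finset U) : Finset P := {p | H p = S}

theorem mem_lookalikes {S : Finset U} {p : P} : p ∈ lookalikes H S ↔ H p = S :=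
  Finset.mem_filter.trans (and_iff_right (Finset.mem_univ p))

/-- The predicted node as which an arriving node is treated, among the candidates `Q`. -/
noncomputable def firstOf (Q : Finset P) : Option P :=
  argmin (Fintype.equivFin P) Q

variable [DecidableEq V] [DecidableEq P]

theorem exists_mem_greedy_lookalikes (σ : P ↪ V) (hσ : ∀ q, N (σ q) = H q) (hvs : ∀ q, σ q ∈ vs)
    (p : P) : ∃ v, (v, p) ∈ greedy firstOf (lookalikes H ∘ N) Finset.univ vs := by
  -- Otherwise the arrivals `σ q` of the lookalikes `q` of `p` are all matched, to other lookalikes.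
  by_contra! hp
  have hmatched (q : P) (hq : q ∈ lookalikes H (H p)) :
      ∃ z, (σ q, z) ∈ greedy firstOf (lookalikes H ∘ N) Finset.univ vs := by
    obtain ⟨z, hz, -⟩ := exists_mem_greedy_of_unmatched (k := Fintype.equivFin P) hp
      (Finset.mem_univ p) (hvs q) (mem_lookalikes.2 ((mem_lookalikes.1 hq).symm.trans (hσ q).symm))
    exact ⟨z, hz⟩
  choose! z hz using hmatched
  have hmaps : ∀ q ∈ lookalikes H (H p), z q ∈ (lookalikes H (H p)).erase p := fun q hq =>
    Finset.mem_erase.2 ⟨fun h => hp _ (h ▸ hz q hq), mem_lookalikes.2 <|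
      (mem_lookalikes.1 (mem_of_mem_greedy (fun _ _ => mem_of_argmin_eq_some) (hz q hq)).2.2).trans
        ((hσ q).trans (mem_lookalikes.1 hq))⟩
  have hinj : Set.InjOn z (lookalikes H (H p)) := fun q hq r hr h =>
    σ.injective (eq_of_mem_greedy_right (fun _ _ => mem_of_argmin_eq_some) (hz q hq)
      (h ▸ hz r hr))
  exact (Finset.card_le_card_of_injOn z hmaps hinj).not_gt
    (Finset.card_erase_lt_of_mem (mem_lookalikes.2 rfl))

theorem exists_embedding_forall_mem_greedy_lookalikes (σ : P ↪ V) (hσ : ∀ q, N (σ q) = H q)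
    (hmem : ∀ q, σ q ∈ vs) (hvs : vs.Nodup) :
    ∃ τ : P ↪ V, ∀ v p, (v, p) ∈ greedy firstOf (lookalikes H ∘ N) Finset.univ vs ↔ τ p = v := by
  choose τ hτ using exists_mem_greedy_lookalikes σ hσ hmem
  refine ⟨⟨τ, fun p q h => ?_⟩, fun v p => ⟨fun h => ?_, fun h => h ▸ hτ p⟩⟩
  · exact eq_of_mem_greedy_left (fun _ _ => mem_of_argmin_eq_some) hvs (hτ p) (h ▸ hτ q)
  · exact eq_of_mem_greedy_right (fun _ _ => mem_of_argmin_eq_some) (hτ p) h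

theorem eq_comp_of_forall_mem_greedy_lookalikes {τ : P → V}
    (hτ : ∀ p, (τ p, p) ∈ greedy firstOf (lookalikes H ∘ N) Finset.univ vs) : H = N ∘ τ :=
  funext fun p => mem_lookalikes.1
    (mem_of_mem_greedy (fun _ _ => mem_of_argmin_eq_some) (hτ p)).2.2

end Identification

section Strategy

variable {V P U : Type*}

open Classical in
/-- The offline node that a matching assigns to `p`. -/
noncomputable def partner (M : Finset (P × U)) (p : P) : Option U :=
  if h : ∃ x, (p, x) ∈ M then some h.choose else none

theorem IsMatching.partner_eq_some_iff {H : P → Finset U} {M : Finset (P × U)}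
    (hM : IsMatching H M) {p : P} {x : U} : partner M p = some x ↔ (p, x) ∈ M := by
  rw [partner]
  split_ifs with h
  · rw [Option.some_inj]
    refine ⟨fun hx => hx ▸ h.choose_spec, fun hx => ?_⟩
    exact congrArg Prod.snd (hM.2 _ h.choose_spec _ hx (.inl rfl))
  · simpa using fun hx => h ⟨x, hx⟩

variable [Fintype P] [DecidableEq P] [DecidableEq U] {H : P → Finset U} {M : Finset (P × U)}
  {c : Finset U → Option U}

/-- The update of the state `(Q, F)` when a node with neighbours `S` arrives: `Q` are the predicted
nodes as which no arrival has been treated yet, `F` the offline nodes that are neither matched nor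
reserved. -/
noncomputable def advance (H : P → Finset U) (c : Finset U → Option U)
    (s : Finset P × Finset U) (S : Finset U) : Finset P × Finset U :=
  (remaining firstOf s.1 (lookalikes H S),
    if firstOf (s.1 ∩ lookalikes H S) = none then remaining c s.2 S else s.2)

/-- The strategy that serves the arrivals treated as predicted nodes by the matching `M`, and the
other ones by the greedy matching with choice `c` on the offline nodes not covered by `M`. -/
noncomputable def reserveStrategy [Fintype U] (H : P → Finset U) (M : Finset (P × U))
    (c : Finset U → Option U) : OnlineStrategy U := fun h S =>
  let s := h.foldl (advance H c) (Finset.univ, (covered M)ᶜ)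
  match firstOf (s.1 ∩ lookalikes H S) with
  | some p => partner M p
  | none => c (s.2 ∩ S)

variable [Fintype U] [DecidableEq V] {N : V → Finset U} {vs : List V} {v : V} {x : U}

theorem mem_offers_reserveStrategy {Q : Finset P} {F : Finset U} {h : List (Finset U)}
    (hs : h.foldl (advance H c) (Finset.univ, (covered M)ᶜ) = (Q, F)) :
    (v, x) ∈ offers (reserveStrategy H M c) N h vs ↔
      (∃ p, (v, p) ∈ greedy firstOf (lookalikes H ∘ N) Q vs ∧ partner M p = some x) ∨
        (v, x) ∈ greedy c N F (abandoned firstOf (lookalikes H ∘ N) Q vs) := by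
  induction vs generalizing Q F h with
  | nil => simp [offers, greedy, abandoned]
  | cons a vs ih =>
    have hs' : (h ++ [N a]).foldl (advance H c) (Finset.univ, (covered M)ᶜ) =
        advance H c (Q, F) (N a) := by rw [List.foldl_append, hs, List.foldl_cons, List.foldl_nil]
    rw [mem_offers_cons, ih (hs'.trans rfl)]
    simp only [reserveStrategy, hs, abandoned, mem_greedy_cons, Function.comp_apply]
    cases firstOf (Q ∩ lookalikes H (N a)) with
    | none => simp [mem_greedy_cons, or_left_comm]
    | some p => simp [or_and_right, exists_or, or_assoc, and_assoc]

theorem offers_reserveStrategy_eq_union (hM : IsMatching H M) {τ : P ↪ V}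
    (hτ : ∀ v p, (v, p) ∈ greedy firstOf (lookalikes H ∘ N) Finset.univ vs ↔ τ p = v) :
    offers (reserveStrategy H M c) N [] vs = M.map (τ.prodMap (.refl U)) ∪
      greedy c N (covered M)ᶜ (abandoned firstOf (lookalikes H ∘ N) Finset.univ vs) := by
  ext ⟨v, x⟩
  rw [mem_offers_reserveStrategy List.foldl_nil, Finset.mem_union]
  refine or_congr_left ?_
  simp only [hτ, hM.partner_eq_some_iff, Finset.mem_map, Prod.exists,
    Function.Embedding.coe_prodMap, Function.Embedding.refl_apply, Prod.map_apply, Prod.mk.injEq]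
  aesop

theorem card_run_reserveStrategy (hM : IsMatching H M) (hc : ∀ S x, c S = some x → x ∈ S)
    (hvs : vs.Nodup) {τ : P ↪ V}
    (hτ : ∀ v p, (v, p) ∈ greedy firstOf (lookalikes H ∘ N) Finset.univ vs ↔ τ p = v) :
    #(run (reserveStrategy H M c) N vs) = #M +
      #(greedy c N (covered M)ᶜ (abandoned firstOf (lookalikes H ∘ N) Finset.univ vs)) := by
  set G := greedy c N (covered M)ᶜ (abandoned firstOf (lookalikes H ∘ N) Finset.univ vs)
  set M' := M.map (τ.prodMap (.refl U))
  have hM' : IsMatching N M' := (isMatching_map τ).2 <|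
    eq_comp_of_forall_mem_greedy_lookalikes (fun p => (hτ _ p).2 rfl) ▸ hM
  have hoffers : offers (reserveStrategy H M c) N [] vs = M' ∪ G :=
    offers_reserveStrategy_eq_union hM hτ
  have hdisj : ∀ e ∈ M', ∀ f ∈ G, e.2 ≠ f.2 := by
    intro e he f hf hef
    obtain ⟨b, hb, rfl⟩ := Finset.mem_map.1 he
    exact Finset.mem_compl.1 (mem_of_mem_greedy hc hf).2.1
      (hef ▸ Finset.mem_image_of_mem Prod.snd hb)
  have hinj : Set.InjOn Prod.snd (G : Set (V × U)) := by
    rintro ⟨a, x⟩ ha ⟨b, y⟩ hb (rfl : x = y)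
    rw [eq_of_mem_greedy_right hc ha hb]
  rw [run, runFrom_eq_union_offers hvs, Finset.empty_union, hoffers, Finset.card_union_of_disjoint,
    Finset.card_map]
  · exact Finset.disjoint_left.2 fun e he hf => hdisj e he e hf rfl
  · rw [hoffers]
    intro e he
    rcases Finset.mem_union.1 he with he | he
    exacts [hM'.1 e he, (mem_of_mem_greedy hc he).2.2]
  · rw [hoffers, Finset.coe_union]
    rintro e (he | he) f (hf | hf) hef
    · exact hM'.injOn_snd he hf hef
    · exact absurd hef (hdisj e he f hf)
    · exact absurd hef.symm (hdisj f hf e he)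
    · exact hinj he hf hef
  · simp

end Strategy

section Expectation

variable {α β : Type*} [Fintype α] (p : PMF α) {g : β → ℝ}

theorem hasSum_bind_toReal_mul {f : α → PMF β} {m : α → ℝ}
    (hm : ∀ a, HasSum (fun b => (f a b).toReal * g b) (m a)) :
    HasSum (fun b => (p.bind f b).toReal * g b) (∑ a, (p a).toReal * m a) := by
  have hbind (b : β) : (p.bind f b).toReal * g b =
      ∑ a, (p a).toReal * ((f a b).toReal * g b) := by
    rw [PMF.bind_apply, tsum_fintype, ENNReal.toReal_sum fun a _ =>
      ENNReal.mul_ne_top (p.apply_ne_top a) ((f a).apply_ne_top b), Finset.sum_mul]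
    exact Finset.sum_congr rfl fun a _ => by rw [ENNReal.toReal_mul, mul_assoc]
  simp_rw [hbind]
  exact hasSum_sum fun a _ => (hm a).mul_left _

theorem hasSum_map_toReal_mul (f : α → β) :
    HasSum (fun b => (p.map f b).toReal * g b) (∑ a, (p a).toReal * g (f a)) := by
  refine hasSum_bind_toReal_mul p fun a => ?_
  convert hasSum_single (f a) fun b hb => ?_
  · simp
  · simp [PMF.pure_apply_of_ne _ _ hb]

end Expectation

section Algorithm

variable {V P U : Type*} [Fintype P] [Fintype U] [DecidableEq U]

/-- The maximum matchings of the predicted graph. -/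
abbrev MaximumMatching (H : P → Finset U) : Type _ :=
  {M : Finset (P × U) // IsMatching H M ∧ #M = matchingNumber H}

instance (H : P → Finset U) : Nonempty (MaximumMatching H) :=
  nonempty_subtype.2 (exists_isMatching_card_eq H)

noncomputable instance (H : P → Finset U) : Fintype (MaximumMatching H) :=
  .ofFinite _

/-- A proportionally fair random maximum matching: no set of offline nodes that some maximum
matching leaves uncovered is covered too often. -/
noncomputable def fairMatching (H : P → Finset U) : PMF (MaximumMatching H) :=
  (exists_pmf_sq_card_le fun M : MaximumMatching H => covered M.1).choose

theorem sq_card_div_le_sum_fairMatching {H : P → Finset U} {B : Finset (P × U)}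
    (hB : IsMatching H B) (hcard : #B = matchingNumber H) {D : Finset U}
    (hD : Disjoint D (covered B)) :
    (#D : ℝ) ^ 2 / (#B + #D) ≤ ∑ M, (fairMatching H M).toReal * #(D \ covered M.1) := by
  refine div_le_of_le_mul₀ (by positivity) (Finset.sum_nonneg fun M _ => by positivity) ?_
  rw [← hB.card_covered]
  exact (exists_pmf_sq_card_le fun M : MaximumMatching H => covered M.1).choose_spec
    ⟨B, hB, hcard⟩ D hD

variable [DecidableEq P]

/-- The strategy for predicted graph `H`: a fair maximum matching is reserved for the predicted
nodes, and RANKING serves the other arrivals. -/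
noncomputable def fairReserve (H : P → Finset U) : PMF (OnlineStrategy U) :=
  (fairMatching H).bind fun M => (rankingLaw U).map (reserveStrategy H M.1)

variable {H : P → Finset U} {M : Finset (P × U)} {N : V → Finset U} {O : Finset (V × U)}
  {vs : List V}

theorem expectedSize_fairReserve (N : V → Finset U) (vs : List V) :
    expectedSize (fairReserve H) N vs = ∑ M, (fairMatching H M).toReal *
      ∫ y : U → unitInterval, (#(run (reserveStrategy H M.1 (rankChoice y)) N vs) : ℝ) := by
  rw [expectedSize, fairReserve,
    (hasSum_bind_toReal_mul _ fun M => hasSum_map_toReal_mul _ _).tsum_eq]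
  exact Finset.sum_congr rfl fun M _ => congrArg _ <|
    sum_rankingLaw_mul fun c => (#(run (reserveStrategy H M.1 c) N vs) : ℝ)

theorem le_integral_card_run_reserveStrategy [DecidableEq V] (hM : IsMatching H M)
    (hvs : vs.Nodup) {τ : P ↪ V}
    (hτ : ∀ v p, (v, p) ∈ greedy firstOf (lookalikes H ∘ N) Finset.univ vs ↔ τ p = v)
    (hO : IsMatching N O) (hOvs : ∀ e ∈ O, e.1 ∈ vs ∧ ∀ p, τ p ≠ e.1) :
    #M + (1 - 1 / Real.exp 1) * #(covered O \ covered M) ≤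
      ∫ y : U → unitInterval, (#(run (reserveStrategy H M (rankChoice y)) N vs) : ℝ) := by
  have hfree : IsMatching N {e ∈ O | e.2 ∉ covered M} := hO.mono (O.filter_subset _)
  have hcov : covered {e ∈ O | e.2 ∉ covered M} = covered O \ covered M := by
    rw [Finset.sdiff_eq_filter]
    exact (Finset.filter_image (p := (· ∉ covered M))).symm
  have hmem_free : ∀ e ∈ ({e ∈ O | e.2 ∉ covered M} : Finset (V × U)),
      e.1 ∈ abandoned firstOf (lookalikes H ∘ N) Finset.univ vs ∧ e.2 ∈ (covered M)ᶜ := by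
    intro e he
    obtain ⟨heO, heM⟩ := Finset.mem_filter.1 he
    obtain ⟨hev, heτ⟩ := hOvs e heO
    refine ⟨(mem_abandoned_or_exists_mem_greedy firstOf _ _ hev).resolve_right ?_,
      Finset.mem_compl.2 heM⟩
    exact fun ⟨p, hp⟩ => heτ p ((hτ _ p).1 hp)
  simp_rw [card_run_reserveStrategy hM (fun _ _ => mem_of_argmin_eq_some) hvs hτ, Nat.cast_add]
  rw [integral_add (integrable_const _) (integrable_comp_rankChoice fun c =>
    (#(greedy c N (covered M)ᶜ (abandoned firstOf (lookalikes H ∘ N) Finset.univ vs)) : ℝ)),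
    integral_const, probReal_univ, one_smul, ← hcov, hfree.card_covered]
  exact add_le_add_right (le_integral_card_greedy_rankChoice hfree hmem_free) _

theorem le_expectedSize_fairReserve [Fintype V] (σ : P ↪ V) (hσ : ∀ p, N (σ p) = H p)
    (hvs : vs.Nodup) (hmem : ∀ v, v ∈ vs) :
    matchingNumber H + (1 - 1 / Real.exp 1) *
      ((matchingNumber N - matchingNumber H) ^ 2 / matchingNumber N) ≤
        expectedSize (fairReserve H) N vs := by
  classical
  obtain ⟨τ, hτ⟩ := exists_embedding_forall_mem_greedy_lookalikes σ hσ (fun q => hmem _) hvs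
  obtain rfl : H = N ∘ τ := eq_comp_of_forall_mem_greedy_lookalikes fun p => (hτ _ p).2 rfl
  obtain ⟨B, O, hB, hBc, hO, hcard, hOτ, hdisj⟩ := exists_maximum_split N τ
  have hfair : (matchingNumber N - matchingNumber (N ∘ τ) : ℝ) ^ 2 / matchingNumber N ≤
      ∑ M, (fairMatching (N ∘ τ) M).toReal * #(covered O \ covered M.1) := by
    convert sq_card_div_le_sum_fairMatching hB hBc hdisj using 2
    · rw [hO.card_covered, ← hcard, ← hBc, Nat.cast_add, add_sub_cancel_left]
    · rw [hO.card_covered, ← hcard, Nat.cast_add]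
  have hexp : 0 ≤ 1 - 1 / Real.exp 1 :=
    sub_nonneg.2 (div_le_one_of_le₀ (Real.one_le_exp zero_le_one) (Real.exp_pos 1).le)
  have hone : ∑ M, (fairMatching (N ∘ τ) M).toReal = 1 := by
    rw [← ENNReal.toReal_sum fun M _ => PMF.apply_ne_top _ M,
      ← tsum_fintype (L := .unconditional _), PMF.tsum_coe, ENNReal.toReal_one]
  calc (matchingNumber (N ∘ τ) : ℝ) + (1 - 1 / Real.exp 1) *
        ((matchingNumber N - matchingNumber (N ∘ τ)) ^ 2 / matchingNumber N)
      ≤ matchingNumber (N ∘ τ) + (1 - 1 / Real.exp 1) *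
          ∑ M, (fairMatching (N ∘ τ) M).toReal * #(covered O \ covered M.1) := by gcongr
    _ = ∑ M, (fairMatching (N ∘ τ) M).toReal * (matchingNumber (N ∘ τ) +
          (1 - 1 / Real.exp 1) * (#(covered O \ covered M.1) : ℝ)) := by
      simp_rw [mul_add, Finset.sum_add_distrib, ← Finset.sum_mul, hone, one_mul,
        mul_left_comm _ (1 - 1 / Real.exp 1), ← Finset.mul_sum]
    _ ≤ expectedSize (fairReserve (N ∘ τ)) N vs := by
      rw [expectedSize_fairReserve]
      gcongr with M
      have hM := le_integral_card_run_reserveStrategy M.2.1 hvs hτ hO fun e he =>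
        ⟨hmem _, hOτ e he⟩
      rwa [M.2.2] at hM

end Algorithm

theorem delta_bound_mul_le {P U : Type*} [Fintype P] [Fintype U] (H : P → Finset U) {d : ℕ}
    (adv : Fin d → Finset U) (κ : ℝ) :
    (1 - delta H adv + delta H adv ^ 2 * κ) * matchingNumber (fullGraph H adv) ≤
      matchingNumber H + κ * ((matchingNumber (fullGraph H adv) - matchingNumber H) ^ 2 /
        matchingNumber (fullGraph H adv)) := by
  rw [delta]
  rcases eq_or_ne (matchingNumber (fullGraph H adv) : ℝ) 0 with h | h
  · simp [h]
  · refine le_of_eq ?_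
    field_simp
    ring

end SemiOnline

theorem mainTheorem2 :
    ∃ A : SemiOnline.RandomizedAlgorithm,
      ∀ (U : Type*) (P : Type*) [Fintype U] [Fintype P]
        (H : P → Finset U) (d : ℕ) (adv : Fin d → Finset U)
        (order : List (P ⊕ Fin d)), order.Nodup → (∀ x, x ∈ order) →
        (1 - SemiOnline.delta H adv + SemiOnline.delta H adv ^ 2 * (1 - 1 / Real.exp 1)) *
            (SemiOnline.matchingNumber (SemiOnline.fullGraph H adv) : ℝ)
          ≤ SemiOnline.expectedSize (A U P H) (SemiOnline.fullGraph H adv) order := by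
  classical
  exact ⟨fun U P _ _ H => SemiOnline.fairReserve H, fun U P _ _ H d adv order hnodup hmem =>
    (SemiOnline.delta_bound_mul_le H adv _).trans <|
      SemiOnline.le_expectedSize_fairReserve .inl (fun _ => rfl) hnodup hmem⟩
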